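/- Let $d\ge 2$, let $M_d$ be the algebra of complex $d\times d$ matrices (operators on $\mathbb C^d$ with standard basis $|0\rangle,\dots,|d-1\rangle$), and let $\mathcal D=\{\rho\in M_d:\rho\ge 0,\ \operatorname{tr}\rho=1\}$ be the set of densities. Let $S\subset M_d$ be a resource set with $S=S^*$. Suppose that $\operatorname{span}_{\mathbb C}(S)$ is a Hörmander system, i.e. the real Lie algebra generated (under the commutator) by the anti-Hermitian elements of $\operatorname{span}_{\mathbb C}(S)$ is $\mathfrak{su}(d)=\{A\in M_d: A^*=-A,\ \operatorname{tr}A=0\}$. Suppose also that $|0\rangle\langle 1|\in S$. Let $\operatorname{chan}(S)$ be the smallest set of linear maps $M_d\to M_d$ that - contains $\rho\mapsto e^{itH}\rho e^{-itH}$ for every $t\ge 0$ and every $H=H^*$ with $iH\in\operatorname{span}_{\mathbb C}(S)$; - contains $e^{tL_a}$ for every $t\ge0$ and every $a\in S$, where $L_a(\rho)=2a\rho a^*-a^*a\rho-\rho a^*a$; - is closed under composition. Then $\operatorname{chan}(S)$ is transitive: for all $\rho,\sigma\in\mathcal D$ there is a family $(T_t)_{t\ge 0}$ in $\operatorname{chan}(S)$,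 with $T_0=\mathrm{id}$ and, for all $0\le s\le t$, $T_t=\Phi\circ T_s$ for some $\Phi\in\operatorname{chan}(S)$, such that $T_\tau(\rho)=\sigma$ for some $\tau>0$ or $\lim_{t\to\infty}T_t(\rho)=\sigma$. -/

import Mathlib

open Filter Topology
open scoped NNReal Matrix ComplexOrder

namespace QControl

/-- Operators on the Hilbert space `ℂ^d`. -/
abbrev Op (d : ℕ) : Type := Matrix (Fin d) (Fin d) ℂ

/-- Superoperators: linear maps on the space of operators. -/
abbrev SuperOp (d : ℕ) : Type := Op d →ₗ[ℂ] Op d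

/-- Density matrices: positive semidefinite with unit trace. -/
def IsDensity {d : ℕ} (ρ : Op d) : Prop :=
  ρ.PosSemidef ∧ ρ.trace = 1

/-- The underlying set of the real Lie algebra `su(d)`: traceless anti-Hermitian matrices. -/
def su (d : ℕ) : Set (Op d) :=
  {A | Aᴴ = -A ∧ A.trace = 0}

section

attribute [local instance] LieRing.ofAssociativeRing

/-- A Hörmander system: a set of anti-Hermitian operators such that the real Lie algebra it
generates (under the commutator) is `su(d)`. -/
def IsHormanderSystem {d : ℕ} (T : Set (Op d)) : Prop :=
  (∀ A ∈ T, Aᴴ = -A) ∧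
    ((LieSubalgebra.lieSpan ℝ (Op d) T : LieSubalgebra ℝ (Op d)) : Set (Op d)) = su d

end

/-- The anti-Hermitian operators in the complex linear span of a resource set `S`. -/
def antiHermitianSpan {d : ℕ} (S : Set (Op d)) : Set (Op d) :=
  {A | A ∈ Submodule.span ℂ S ∧ Aᴴ = -A}

/-- The unitary channel `ρ ↦ e^{itH} ρ e^{-itH}`. -/
noncomputable def unitaryFlow {d : ℕ} (H : Op d) (t : ℝ) : SuperOp d where
  toFun ρ := NormedSpace.exp ((Complex.I * (t : ℂ)) • H) * ρ *
    NormedSpace.exp (-((Complex.I * (t : ℂ)) • H))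
  map_add' x y := by rw [mul_add, add_mul]
  map_smul' c x := by simp

/-- The Lindblad generator `L_a(ρ) = 2 a ρ a* - a* a ρ - ρ a* a` of a jump operator `a`. -/
noncomputable def lindbladian {d : ℕ} (a : Op d) : SuperOp d where
  toFun ρ := (2 : ℂ) • (a * ρ * aᴴ) - aᴴ * a * ρ - ρ * (aᴴ * a)
  map_add' x y := by
    simp only [mul_add, add_mul, smul_add]
    abel
  map_smul' c x := by
    simp only [Matrix.mul_smul, Matrix.smul_mul, RingHom.id_apply, smul_sub]
    rw [smul_comm]

/-- The exponential `e^{tL}` of a superoperator `L`: the linear map whose matrix in the basis of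
matrix units is the exponential of `t` times the matrix of `L`. -/
noncomputable def semigroup {d : ℕ} (L : SuperOp d) (t : ℝ) : SuperOp d :=
  (LinearMap.toMatrixAlgEquiv (Matrix.stdBasis ℂ (Fin d) (Fin d))).symm
    (NormedSpace.exp ((t : ℂ) • LinearMap.toMatrixAlgEquiv (Matrix.stdBasis ℂ (Fin d) (Fin d)) L))

/-- The class `chan(S)`: the smallest class of superoperators that contains the unitary channels of
the Hamiltonians `H` with `iH` in the span of `S`, contains the Lindblad semigroups of the jump
operators in `S`, and is closed under composition. -/
inductive Chan {d : ℕ} (S : Set (Op d)) : SuperOp d → Prop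
  | unitary (H : Op d) (t : ℝ) (hH : H.IsHermitian) (hS : Complex.I • H ∈ Submodule.span ℂ S)
      (ht : 0 ≤ t) : Chan S (unitaryFlow H t)
  | jump (a : Op d) (t : ℝ) (ha : a ∈ S) (ht : 0 ≤ t) : Chan S (semigroup (lindbladian a) t)
  | comp (Φ Ψ : SuperOp d) (hΦ : Chan S Φ) (hΨ : Chan S Ψ) : Chan S (Φ ∘ₗ Ψ)

/-- The class `chan(S)` as a set. -/
def chan {d : ℕ} (S : Set (Op d)) : Set (SuperOp d) :=
  {Φ | Chan S Φ}

/-- An evolution `(T_t)_{t ≥ 0}` within a set of operations: it starts at the identity, and for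
`s ≤ t` the passage from `T_s` to `T_t` is an operation of the set (so every `T_t` is one too). -/
def IsEvolution {d : ℕ} (O : Set (SuperOp d)) (T : ℝ≥0 → SuperOp d) : Prop :=
  T 0 = LinearMap.id ∧ ∀ s t : ℝ≥0, s ≤ t → ∃ Φ ∈ O, T t = Φ ∘ₗ T s

/-- A set of operations is transitive if any density `ρ` can be steered to any density `σ` by an
evolution within the set, either at some finite time `τ > 0` or in the limit `t → ∞`. -/
def IsTransitive {d : ℕ} (O : Set (SuperOp d)) : Prop :=
  ∀ ρ σ : Op d, IsDensity ρ → IsDensity σ →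
    ∃ T : ℝ≥0 → SuperOp d, IsEvolution O T ∧
      ((∃ τ : ℝ≥0, 0 < τ ∧ T τ ρ = σ) ∨ Tendsto (fun t => T t ρ) atTop (𝓝 σ))

end QControl

/-! It suffices to steer approximately: if every density can be brought arbitrarily near every
other, then successive corrections into shrinking neighbourhoods of the target give an evolution
converging to it (`isTransitive_of_reach`), so the limit alternative always holds. `Reach` records
this closure relation, which is transitive.

Two resources are combined. First, the closure of the available unitaries is a closed submonoid of
the unitary group. By the Lie product formula its tangent directions form a Lie algebra; this
contains the Hörmander system, hence `su d`, and phases act trivially under conjugation, so the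
closure is all of the unitary group (`unitary_le_topologicalClosure`). Second, the jump |0⟩⟨1|
generates amplitude damping, which on diagonal states moves any fraction of the weight at one site
to another, the whole of it in the limit. Permutation unitaries carry this to every pair of sites,
and such transfers connect any two probability vectors (`reach_realDiagonal`). To join two
densities, diagonalise the first, redistribute its eigenvalues, and rotate to the eigenbasis of the
second. -/

namespace QControl

/-! ### Lie product formula and the tangent Lie algebra of a closed unitary submonoid -/

section LieTrotter

variable {A : Type*} [NormedRing A]

/-- Telescoping estimate: errors of the n factors add up without amplification. In the application
`b ^ n` is again an exponential, so its powers are bounded directly. -/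
theorem norm_pow_sub_pow_le {a b : A} (ha : ‖a‖ ≤ 1) (hb : ∀ n : ℕ, ‖b ^ n‖ ≤ 1) (n : ℕ) :
    ‖a ^ n - b ^ n‖ ≤ n * ‖a - b‖ := by
  induction n with
  | zero => simp
  | succ n ih =>
    have h : a ^ (n + 1) - b ^ (n + 1) = a * (a ^ n - b ^ n) + (a - b) * b ^ n := by
      rw [pow_succ', pow_succ', mul_sub, sub_mul]; abel
    calc ‖a ^ (n + 1) - b ^ (n + 1)‖
        ≤ ‖a‖ * ‖a ^ n - b ^ n‖ + ‖a - b‖ * ‖b ^ n‖ := by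
          rw [h]
          exact (norm_add_le _ _).trans (add_le_add (norm_mul_le _ _) (norm_mul_le _ _))
      _ ≤ 1 * (n * ‖a - b‖) + ‖a - b‖ * 1 := by
          gcongr
          exact hb n
      _ = ((n + 1 : ℕ) : ℝ) * ‖a - b‖ := by push_cast; ring

variable [NormedAlgebra ℝ A] [CompleteSpace A]

theorem exp_inv_smul_pow (X : A) {n : ℕ} (hn : n ≠ 0) :
    NormedSpace.exp ((n : ℝ)⁻¹ • X) ^ n = NormedSpace.exp X := by
  let +nondep : NormedAlgebra ℚ A := .restrictScalars ℚ ℝ A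
  rw [← NormedSpace.exp_nsmul, ← Nat.cast_smul_eq_nsmul ℝ, smul_smul,
    mul_inv_cancel₀ (by exact_mod_cast hn), one_smul]

theorem exp_add_smul (X : A) (s t : ℝ) :
    NormedSpace.exp ((s + t) • X) = NormedSpace.exp (s • X) * NormedSpace.exp (t • X) := by
  let +nondep : NormedAlgebra ℚ A := .restrictScalars ℚ ℝ A
  rw [add_smul]
  exact NormedSpace.exp_add_of_commute (((Commute.refl X).smul_left s).smul_right t)

/-- The Lie product formula, for a closed submonoid of contractions: a limit of products
`(c (1/n))^n` along a curve `c` tangent to `exp (t X)` is `exp X`. -/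
theorem exp_mem_of_hasDerivAt {G : Submonoid A} (hG : IsClosed (G : Set A))
    (hnorm : ∀ g ∈ G, ‖g‖ ≤ 1) {c : ℝ → A} (hc : ∀ t, c t ∈ G) (hc0 : c 0 = 1) {X : A}
    (hX : HasDerivAt c X 0) (hXnorm : ∀ t : ℝ, ‖NormedSpace.exp (t • X)‖ ≤ 1) :
    NormedSpace.exp X ∈ G := by
  -- The two curves agree to first order, so they differ by o(1/n) at 1/n; n such errors still tend
  -- to 0.
  have hD : HasDerivAt (fun t : ℝ => c t - NormedSpace.exp (t • X)) 0 0 := by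
    have h := hX.sub (hasDerivAt_exp_smul_const (𝕂 := ℝ) X 0)
    rw [zero_smul, NormedSpace.exp_zero, one_mul, sub_self] at h
    exact h
  have hinv : Tendsto (fun n : ℕ => ((n : ℝ)⁻¹)) atTop (𝓝[≠] 0) := by
    refine tendsto_nhdsWithin_iff.mpr ⟨tendsto_inv_atTop_nhds_zero_nat, ?_⟩
    filter_upwards [eventually_ne_atTop 0] with n hn
    simpa using hn
  have hlim := (hasDerivAt_iff_tendsto_slope.mp hD).comp hinv
  refine hG.mem_of_tendsto (b := atTop) (f := fun n : ℕ => c ((n : ℝ)⁻¹) ^ n) ?_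
    (Eventually.of_forall fun n => pow_mem (hc _) n)
  rw [tendsto_iff_norm_sub_tendsto_zero]
  refine squeeze_zero' (Eventually.of_forall fun _ => norm_nonneg _) ?_
    (tendsto_zero_iff_norm_tendsto_zero.mp hlim)
  filter_upwards [eventually_ne_atTop 0] with n hn
  have h1 := norm_pow_sub_pow_le (a := c ((n : ℝ)⁻¹)) (b := NormedSpace.exp ((n : ℝ)⁻¹ • X))
    (hnorm _ (hc _)) (fun m => by
      let +nondep : NormedAlgebra ℚ A := .restrictScalars ℚ ℝ A
      rw [← NormedSpace.exp_nsmul, ← Nat.cast_smul_eq_nsmul ℝ, smul_smul]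
      exact hXnorm _) n
  rw [exp_inv_smul_pow X hn] at h1
  refine h1.trans (le_of_eq ?_)
  simp [slope, hc0, norm_smul]

theorem exp_neg_smul_mul_exp_smul (X : A) (t : ℝ) :
    NormedSpace.exp ((-t) • X) * NormedSpace.exp (t • X) = 1 := by
  rw [← exp_add_smul, neg_add_cancel, zero_smul, NormedSpace.exp_zero]

theorem exp_smul_conj (X Y : A) (t : ℝ) :
    NormedSpace.exp (NormedSpace.exp (t • X) * Y * NormedSpace.exp ((-t) • X)) =
      NormedSpace.exp (t • X) * NormedSpace.exp Y * NormedSpace.exp ((-t) • X) := by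
  let +nondep : NormedAlgebra ℚ A := .restrictScalars ℚ ℝ A
  have h : SemiconjBy (NormedSpace.exp (t • X)) Y
      (NormedSpace.exp (t • X) * Y * NormedSpace.exp ((-t) • X)) := by
    rw [SemiconjBy, mul_assoc _ (NormedSpace.exp ((-t) • X)), exp_neg_smul_mul_exp_smul, mul_one]
  rw [h.exp_right.eq, mul_assoc (NormedSpace.exp _) (NormedSpace.exp (t • X)), ← exp_add_smul,
    add_neg_cancel, zero_smul, NormedSpace.exp_zero, mul_one]

variable [StarRing A] [CStarRing A] [StarModule ℝ A]

theorem exp_smul_mem_unitary {X : A} (hX : star X = -X) (t : ℝ) :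
    NormedSpace.exp (t • X) ∈ unitary A := by
  let +nondep : NormedAlgebra ℚ A := .restrictScalars ℚ ℝ A
  refine NormedSpace.exp_mem_unitary_of_mem_skewAdjoint ?_
  rw [skewAdjoint.mem_iff, star_smul, hX, smul_neg, star_trivial]

theorem norm_exp_smul_le [Nontrivial A] {X : A} (hX : star X = -X) (t : ℝ) :
    ‖NormedSpace.exp (t • X)‖ ≤ 1 :=
  (CStarRing.norm_of_mem_unitary (exp_smul_mem_unitary hX t)).le

/-- The curve exp(tX) exp(tY) stays in `G` and has velocity X + Y at 0. -/
theorem exp_add_mem [Nontrivial A] {G : Submonoid A} (hG : IsClosed (G : Set A))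
    (hU : G ≤ unitary A) {X Y : A} (hX : star X = -X) (hY : star Y = -Y)
    (hXG : ∀ t : ℝ, NormedSpace.exp (t • X) ∈ G) (hYG : ∀ t : ℝ, NormedSpace.exp (t • Y) ∈ G) :
    NormedSpace.exp (X + Y) ∈ G := by
  refine exp_mem_of_hasDerivAt hG (fun g hg => (CStarRing.norm_of_mem_unitary (hU hg)).le)
    (c := fun t : ℝ => NormedSpace.exp (t • X) * NormedSpace.exp (t • Y))
    (fun t => mul_mem (hXG t) (hYG t)) (by simp) ?_
    (norm_exp_smul_le (by rw [star_add, hX, hY, neg_add]))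
  have h := (hasDerivAt_exp_smul_const (𝕂 := ℝ) X 0).mul (hasDerivAt_exp_smul_const (𝕂 := ℝ) Y 0)
  simp only [zero_smul, NormedSpace.exp_zero, one_mul, mul_one] at h
  exact h

section

attribute [local instance] LieRing.ofAssociativeRing

/-- The Lie algebra of a closed submonoid of the unitary group: the skew-adjoint elements whose
one-parameter group lies in the submonoid. -/
def tangentLieSubalgebra [Nontrivial A] (G : Submonoid A) (hG : IsClosed (G : Set A))
    (hU : G ≤ unitary A) : LieSubalgebra ℝ A where
  carrier := {X | star X = -X ∧ ∀ t : ℝ, NormedSpace.exp (t • X) ∈ G}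
  zero_mem' := ⟨by simp, fun t => by simp [G.one_mem]⟩
  add_mem' := by
    rintro X Y ⟨hX, hXG⟩ ⟨hY, hYG⟩
    refine ⟨by rw [star_add, hX, hY, neg_add], fun t => ?_⟩
    rw [smul_add]
    refine exp_add_mem hG hU (by simp [hX]) (by simp [hY]) (fun s => ?_) (fun s => ?_)
    · rw [smul_smul]; exact hXG _
    · rw [smul_smul]; exact hYG _
  smul_mem' := by
    rintro r X ⟨hX, hXG⟩
    refine ⟨by simp [hX], fun t => ?_⟩
    rw [smul_smul]
    exact hXG _
  lie_mem' := by
    rintro X Y ⟨hX, hXG⟩ ⟨hY, hYG⟩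
    let +nondep : NormedAlgebra ℚ A := .restrictScalars ℚ ℝ A
    -- The adjoint orbit of `Y` has velocity ⁅X, Y⁆ at 0. Its difference quotients are linear
    -- combinations of tangent elements, and `G` is closed, so the bracket is tangent as well.
    let c : ℝ → A := fun s => NormedSpace.exp (s • X) * Y * NormedSpace.exp ((-s) • X)
    have hc0 : c 0 = Y := by simp [c]
    have hexp (s : ℝ) : star (NormedSpace.exp (s • X)) = NormedSpace.exp ((-s) • X) := by
      rw [NormedSpace.star_exp, star_smul, hX, star_trivial, smul_neg, neg_smul]
    have hstar (s : ℝ) : star (c s) = -c s := by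
      simp only [c, star_mul, hexp, hY, neg_neg]
      noncomm_ring
    have hcG (s t : ℝ) : NormedSpace.exp (t • c s) ∈ G := by
      have h : t • c s = NormedSpace.exp (s • X) * (t • Y) * NormedSpace.exp ((-s) • X) := by
        simp [c]
      rw [h, exp_smul_conj]
      exact mul_mem (mul_mem (hXG s) (hYG t)) (hXG (-s))
    have hder : HasDerivAt c ⁅X, Y⁆ 0 := by
      have h1 := (hasDerivAt_exp_smul_const (𝕂 := ℝ) X 0).mul_const Y
      have h2 : HasDerivAt (fun s : ℝ => NormedSpace.exp ((-s) • X)) (-X) 0 := by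
        have h := hasDerivAt_exp_smul_const (𝕂 := ℝ) (-X) 0
        simpa using h
      have h := h1.mul h2
      simp only [neg_zero, zero_smul, NormedSpace.exp_zero, one_mul, mul_one, mul_neg,
        ← sub_eq_add_neg] at h
      exact h
    have hlim := hasDerivAt_iff_tendsto_slope.mp hder
    have hmem (s : ℝ) : star (slope c 0 s) = -slope c 0 s ∧
        ∀ t : ℝ, NormedSpace.exp (t • slope c 0 s) ∈ G := by
      have hs : slope c 0 s = s⁻¹ • c s + (-s⁻¹) • Y := by
        simp [slope, hc0, sub_eq_add_neg]
      rw [hs]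
      refine ⟨by simp [hstar, hY, add_comm], fun t => ?_⟩
      rw [smul_add]
      refine exp_add_mem hG hU (by simp [hstar]) (by simp [hY]) (fun r => ?_) (fun r => ?_)
      · rw [smul_smul, smul_smul]; exact hcG _ _
      · rw [smul_smul, smul_smul]; exact hYG _
    refine ⟨?_, fun t => ?_⟩
    · simp [Ring.lie_def, hX, hY]
    · have hcont : Continuous fun Z : A => NormedSpace.exp (t • Z) :=
        NormedSpace.exp_continuous.comp (continuous_const_smul t)
      exact hG.mem_of_tendsto ((hcont.tendsto _).comp hlim)
        (Eventually.of_forall fun s => (hmem s).2 t)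

end

end LieTrotter
-- Density of the available unitaries
/-- The unitaries whose conjugation is an operation of `chan S`. -/
def chanUnitaries {d : ℕ} (S : Set (Op d)) : Submonoid (Op d) where
  carrier := {U | U ∈ unitary (Op d) ∧ ∃ Φ, Chan S Φ ∧ ∀ ρ, Φ ρ = U * ρ * Uᴴ}
  one_mem' := ⟨one_mem _, unitaryFlow 0 0,
    .unitary 0 0 Matrix.isHermitian_zero (by simp) le_rfl, fun ρ => by simp [unitaryFlow]⟩
  mul_mem' := by
    rintro U V ⟨hU, Φ, hΦ, hΦU⟩ ⟨hV, Ψ, hΨ, hΨV⟩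
    refine ⟨mul_mem hU hV, Φ ∘ₗ Ψ, .comp _ _ hΦ hΨ, fun ρ => ?_⟩
    simp [hΦU, hΨV, mul_assoc]

theorem chan_id {d : ℕ} (S : Set (Op d)) : Chan S LinearMap.id := by
  have h : unitaryFlow (0 : Op d) 0 = LinearMap.id := by ext; simp [unitaryFlow]
  exact h ▸ .unitary 0 0 Matrix.isHermitian_zero (by simp) le_rfl

section Norm

open scoped Matrix.Norms.L2Operator

/-- The operator-norm algebra structure on `Op d` over `ℝ`, with the entrywise scalar action. -/
@[reducible]
noncomputable def realNormedAlgebra (d : ℕ) : NormedAlgebra ℝ (Op d) where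
  norm_smul_le r x := by
    have h : r • x = (r : ℂ) • x := by ext; simp
    rw [h, norm_smul, Complex.norm_real]

attribute [local instance] realNormedAlgebra LieRing.ofAssociativeRing

variable {d : ℕ} {S : Set (Op d)}

theorem exp_smul_mem_chanUnitaries {X : Op d} (hX : X ∈ antiHermitianSpan S) (t : ℝ) :
    NormedSpace.exp (t • X) ∈ chanUnitaries S := by
  obtain ⟨hXS, hX⟩ := hX
  refine ⟨exp_smul_mem_unitary hX t, ?_⟩
  have hadj : (NormedSpace.exp (t • X))ᴴ = NormedSpace.exp (-(t • X)) := by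
    rw [← Matrix.exp_conjTranspose, Matrix.conjTranspose_smul, hX, star_trivial, smul_neg]
  -- Only nonnegative times are allowed, so for negative `t` the Hamiltonian changes sign instead.
  rcases le_total 0 t with ht | ht
  · refine ⟨unitaryFlow (-Complex.I • X) t, .unitary _ t ?_ ?_ ht, fun ρ => ?_⟩
    · simp [Matrix.IsHermitian, hX]
    · rw [smul_smul]; simpa using hXS
    · have h : (Complex.I * (t : ℂ)) • (-Complex.I • X) = t • X := by
        rw [smul_smul, ← Complex.coe_smul]
        congr 1
        linear_combination (-(t : ℂ)) * Complex.I_mul_I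
      rw [hadj]
      simp only [unitaryFlow, LinearMap.coe_mk, AddHom.coe_mk, h]
  · refine ⟨unitaryFlow (Complex.I • X) (-t), .unitary _ (-t) ?_ ?_ (by linarith), fun ρ => ?_⟩
    · simp [Matrix.IsHermitian, hX]
    · rw [smul_smul]; simpa using hXS
    · have h : (Complex.I * ((-t : ℝ) : ℂ)) • (Complex.I • X) = t • X := by
        rw [smul_smul, ← Complex.coe_smul]
        congr 1
        push_cast
        linear_combination (-(t : ℂ)) * Complex.I_mul_I
      rw [hadj]
      simp only [unitaryFlow, LinearMap.coe_mk, AddHom.coe_mk, h]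

/-- Global phases conjugate trivially; they supply the direction of u(d) missing from `su d`. -/
theorem exp_smul_scalar_mem_chanUnitaries (S : Set (Op d)) (r t : ℝ) :
    NormedSpace.exp (t • (r * Complex.I) • (1 : Op d)) ∈ chanUnitaries S := by
  have hu := exp_smul_mem_unitary (X := (r * Complex.I) • (1 : Op d))
    (by simp) t
  refine ⟨hu, LinearMap.id, chan_id S, fun ρ => ?_⟩
  have hcomm : Commute ρ (NormedSpace.exp (t • (r * Complex.I) • (1 : Op d))) := by
    let +nondep : NormedAlgebra ℚ (Op d) := .restrictScalars ℚ ℝ (Op d)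
    exact SemiconjBy.exp_right (((Commute.one_right ρ).smul_right _).smul_right _)
  rw [← hcomm.eq, mul_assoc, ← Matrix.star_eq_conjTranspose, Unitary.mul_star_self_of_mem hu,
    mul_one]
  rfl

/-- A logarithm by functional calculus. The spectrum is finite, so the branch cut of `arg` does not
spoil continuity. -/
theorem exists_skew_exp_eq {U : Op d} (hU : U ∈ unitary (Op d)) :
    ∃ X : Op d, Xᴴ = -X ∧ NormedSpace.exp X = U := by
  have hn : IsStarNormal U := ⟨by
    rw [Commute, SemiconjBy, Unitary.star_mul_self_of_mem hU, Unitary.mul_star_self_of_mem hU]⟩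
  have hfin : (spectrum ℂ U).Finite := Matrix.finite_spectrum U
  have hcont (f : ℂ → ℂ) : ContinuousOn f (spectrum ℂ U) := hfin.continuousOn f
  let g : ℂ → ℂ := fun z => Complex.I * Complex.arg z
  have hg : star (cfc g U) = -cfc g U := by
    rw [← cfc_star, ← cfc_neg]
    refine cfc_congr fun z _ => ?_
    simp [g]
  refine ⟨cfc g U, hg, ?_⟩
  have hgn : IsStarNormal (cfc g U) := cfc_predicate g U
  rw [← CFC.complex_exp_eq_normedSpace_exp, ← cfc_comp' Complex.exp g U
    (Complex.continuous_exp.continuousOn) (hcont _)]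
  conv_rhs => rw [← cfc_id ℂ U]
  refine cfc_congr fun z hz => ?_
  have hz1 : ‖z‖ = 1 := by
    simpa using spectrum.subset_circle_of_unitary hU hz
  have h := Complex.norm_mul_exp_arg_mul_I z
  rw [hz1, Complex.ofReal_one, one_mul] at h
  simpa [g, mul_comm] using h

/-- Operators generated by a Hörmander system approximate every unitary conjugation. -/
theorem unitary_le_topologicalClosure [NeZero d]
    (hS : IsHormanderSystem (antiHermitianSpan S)) :
    unitary (Op d) ≤ (chanUnitaries S).topologicalClosure := by
  have hclosed : IsClosed ((chanUnitaries S).topologicalClosure : Set (Op d)) :=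
    Submonoid.isClosed_topologicalClosure _
  have hle : (chanUnitaries S).topologicalClosure ≤ unitary (Op d) :=
    Submonoid.topologicalClosure_minimal _ (fun U hU => hU.1) isClosed_unitary
  let 𝔨 := tangentLieSubalgebra _ hclosed hle
  have hsu : su d ⊆ (𝔨 : Set (Op d)) := by
    rw [← hS.2]
    refine (LieSubalgebra.lieSpan_le (K := 𝔨)).mpr fun X hX => ?_
    exact ⟨hX.2, fun t => Submonoid.le_topologicalClosure _ (exp_smul_mem_chanUnitaries hX t)⟩
  intro U hU
  obtain ⟨X, hX, rfl⟩ := exists_skew_exp_eq hU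
  have htr : X.trace = (X.trace.im : ℂ) * Complex.I := by
    have h := congrArg Matrix.trace hX
    rw [Matrix.trace_conjTranspose, Matrix.trace_neg] at h
    have hre := congrArg Complex.re h
    simp at hre
    apply Complex.ext <;> simp
    linarith
  have hd : (d : ℂ) ≠ 0 := by exact_mod_cast NeZero.ne d
  -- Chosen so that subtracting the scalar matrix `r * I` makes `X` traceless.
  set r : ℝ := X.trace.im / d
  have hr : (r * Complex.I) * d = X.trace := by
    rw [htr]
    simp only [r]
    push_cast
    field_simp
  have h1 : X - (r * Complex.I) • (1 : Op d) ∈ 𝔨 := by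
    refine hsu ⟨?_, ?_⟩
    · simp [hX]; abel
    · rw [Matrix.trace_sub, Matrix.trace_smul, Matrix.trace_one, Fintype.card_fin, smul_eq_mul, hr,
        sub_self]
  have h2 : (r * Complex.I) • (1 : Op d) ∈ 𝔨 :=
    ⟨by simp, fun t => Submonoid.le_topologicalClosure _
      (exp_smul_scalar_mem_chanUnitaries S r t)⟩
  have h3 := (𝔨.add_mem h1 h2).2 1
  rwa [sub_add_cancel, one_smul] at h3

end Norm

/-! ### Superoperator semigroups on eigenvectors -/

section Norm

open scoped Matrix.Norms.L2Operator

theorem exp_mulVec_of_mulVec_eq_smul {n : Type*} [Fintype n] [DecidableEq n] {M : Matrix n n ℂ}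
    {v : n → ℂ} {μ : ℂ} (h : M *ᵥ v = μ • v) :
    NormedSpace.exp M *ᵥ v = Complex.exp μ • v := by
  have hpow (k : ℕ) : M ^ k *ᵥ v = μ ^ k • v := by
    induction k with
    | zero => simp
    | succ k ih =>
      rw [pow_succ, ← Matrix.mulVec_mulVec, h, Matrix.mulVec_smul, ih, smul_smul, pow_succ']
  have h1 := (NormedSpace.exp_series_hasSum_exp' (𝕂 := ℂ) M).map
    (Matrix.mulVecBilin ℂ ℂ |>.flip v) (by
      exact LinearMap.continuous_of_finiteDimensional _)
  have h2 := (NormedSpace.exp_series_hasSum_exp' (𝕂 := ℂ) μ).smul_const v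
  rw [Complex.exp_eq_exp_ℂ]
  refine h1.unique ?_
  convert h2 using 2 with k
  simp [hpow, smul_smul]

end Norm

theorem semigroup_apply_of_eigenvector {d : ℕ} {L : SuperOp d} {v : Op d} {μ : ℂ} (h : L v = μ • v)
    (t : ℝ) : semigroup L t v = Complex.exp (t * μ) • v := by
  let b := Matrix.stdBasis ℂ (Fin d) (Fin d)
  have hrepr (f : SuperOp d) (x : Op d) :
      LinearMap.toMatrixAlgEquiv b f *ᵥ ⇑(b.repr x) = ⇑(b.repr (f x)) :=
    LinearMap.toMatrix_mulVec_repr b b f x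
  apply b.repr.injective
  apply DFunLike.coe_injective
  rw [← hrepr, semigroup, AlgEquiv.apply_symm_apply, exp_mulVec_of_mulVec_eq_smul (μ := t * μ)]
  · simp
  · rw [Matrix.smul_mulVec, hrepr, h]
    simp [smul_smul]

/-! ### Approximate reachability -/

/-- A superoperator that maps densities to densities. -/
def PreservesDensity {d : ℕ} (Φ : SuperOp d) : Prop :=
  ∀ ρ, IsDensity ρ → IsDensity (Φ ρ)

theorem IsDensity.unitary_conj {d : ℕ} {U ρ : Op d} (hU : U ∈ unitary (Op d)) (hρ : IsDensity ρ) :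
    IsDensity (U * ρ * Uᴴ) := by
  refine ⟨hρ.1.mul_mul_conjTranspose_same U, ?_⟩
  rw [Matrix.trace_mul_comm, ← mul_assoc, ← Matrix.star_eq_conjTranspose,
    Unitary.star_mul_self_of_mem hU, one_mul, hρ.2]

/-- `σ` is a limit of states to which density-preserving operations of `chan S` steer `ρ`. -/
def Reach {d : ℕ} (S : Set (Op d)) (ρ σ : Op d) : Prop :=
  σ ∈ closure {τ | ∃ Φ, Chan S Φ ∧ PreservesDensity Φ ∧ Φ ρ = τ}

namespace Reach

variable {d : ℕ} {S : Set (Op d)} {ρ σ τ : Op d}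

theorem of_chan {Φ : SuperOp d} (hΦ : Chan S Φ) (hd : PreservesDensity Φ) (ρ : Op d) :
    Reach S ρ (Φ ρ) :=
  subset_closure ⟨Φ, hΦ, hd, rfl⟩

theorem refl (S : Set (Op d)) (ρ : Op d) : Reach S ρ ρ :=
  of_chan (chan_id S) (fun _ h => h) ρ

theorem chan_apply {Φ : SuperOp d} (hΦ : Chan S Φ) (hd : PreservesDensity Φ) (h : Reach S ρ σ) :
    Reach S ρ (Φ σ) := by
  refine Set.MapsTo.closure ?_ Φ.continuous_of_finiteDimensional h
  rintro _ ⟨Ψ, hΨ, hdΨ, rfl⟩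
  exact ⟨Φ ∘ₗ Ψ, .comp _ _ hΦ hΨ, fun ρ hρ => hd _ (hdΨ _ hρ), rfl⟩

theorem trans (h₁ : Reach S ρ σ) (h₂ : Reach S σ τ) : Reach S ρ τ := by
  refine closure_minimal ?_ isClosed_closure h₂
  rintro _ ⟨Φ, hΦ, hd, rfl⟩
  exact h₁.chan_apply hΦ hd

theorem unitary_conj [NeZero d] (hS : IsHormanderSystem (antiHermitianSpan S)) {U : Op d}
    (hU : U ∈ unitary (Op d)) (ρ : Op d) : Reach S ρ (U * ρ * Uᴴ) := by
  have hc : Continuous fun V : Op d => V * ρ * Vᴴ := by fun_prop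
  refine Set.MapsTo.closure (s := (chanUnitaries S : Set (Op d))) ?_ hc
    (unitary_le_topologicalClosure hS hU)
  rintro V ⟨hV, Φ, hΦ, h⟩
  exact ⟨Φ, hΦ, fun τ hτ => h τ ▸ hτ.unitary_conj hV, h ρ⟩

end Reach

/-! ### Permutations and amplitude damping -/

/-- The diagonal operator with given real diagonal. -/
noncomputable def realDiagonal {d : ℕ} (p : Fin d → ℝ) : Op d :=
  Matrix.diagonal fun i => (p i : ℂ)

variable {d : ℕ} {S : Set (Op d)}

theorem reach_realDiagonal_perm [NeZero d] (hS : IsHormanderSystem (antiHermitianSpan S))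
    (p : Fin d → ℝ) (e : Equiv.Perm (Fin d)) :
    Reach S (realDiagonal p) (realDiagonal (p ∘ e)) := by
  have hU : e.permMatrix ℂ ∈ unitary (Op d) := by
    rw [Unitary.mem_iff, Matrix.star_eq_conjTranspose, Matrix.conjTranspose_permMatrix,
      ← Matrix.permMatrix_mul, ← Matrix.permMatrix_mul]
    simp
  have h := Reach.unitary_conj hS hU (realDiagonal p)
  convert h using 1
  rw [Matrix.conjTranspose_permMatrix]
  ext i j
  simp [realDiagonal, Equiv.Perm.permMatrix, PEquiv.toMatrix_toPEquiv_mul,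
    PEquiv.mul_toMatrix_toPEquiv, Matrix.diagonal_apply, Equiv.Perm.inv_def]

theorem single_mul_mul_single_same (ρ : Op d) (i j : Fin d) :
    Matrix.single i j (1 : ℂ) * ρ * Matrix.single j i (1 : ℂ) = ρ j j • Matrix.single i i 1 := by
  rw [Matrix.single_mul_mul_single]
  simp

theorem lindbladian_single_apply (i j : Fin d) (ρ : Op d) :
    lindbladian (Matrix.single i j (1 : ℂ)) ρ =
      (2 * ρ j j) • Matrix.single i i (1 : ℂ) - Matrix.single j j (1 : ℂ) * ρ -
        ρ * Matrix.single j j (1 : ℂ) := by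
  simp only [lindbladian, LinearMap.coe_mk, AddHom.coe_mk, Matrix.conjTranspose_single, star_one,
    single_mul_mul_single_same, Matrix.single_mul_single_same, mul_one, mul_smul]

/-- The amplitude damping semigroup in Kraus form. -/
theorem semigroup_single_apply {i j : Fin d} (hij : i ≠ j) (t : ℝ) (ρ : Op d) :
    semigroup (lindbladian (Matrix.single i j (1 : ℂ))) t ρ =
      (1 + (Complex.exp (-t) - 1) • Matrix.single j j (1 : ℂ)) * ρ *
        (1 + (Complex.exp (-t) - 1) • Matrix.single j j (1 : ℂ)) +
      ((1 - Complex.exp (-t) ^ 2) * ρ j j) • Matrix.single i i (1 : ℂ) := by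
  set P : Op d := Matrix.single j j 1 with hPdef
  set E : Op d := Matrix.single i i 1 with hE
  set L := lindbladian (Matrix.single i j (1 : ℂ)) with hLdef
  have hL (τ : Op d) : L τ = (2 * τ j j) • E - P * τ - τ * P := lindbladian_single_apply i j τ
  have hPP : P * P = P := by simp [hPdef]
  have hPQ : P * (1 - P) = 0 := by rw [mul_sub, hPP, mul_one, sub_self]
  have hQP : (1 - P) * P = 0 := by rw [sub_mul, hPP, one_mul, sub_self]
  have hPE : P * E = 0 := by simp [hPdef, hE, hij.symm]
  have hEP : E * P = 0 := by simp [hPdef, hE, hij]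
  have hEj : E j j = 0 := by simp [hE, hij]
  have hPj : P j j = 1 := by simp [hPdef]
  have hleft (τ : Op d) (h : P * τ = 0) : τ j j = 0 := by
    have h' := congrFun (congrFun h j) j
    simpa [hPdef] using h'
  have hright (τ : Op d) (h : τ * P = 0) : τ j j = 0 := by
    have h' := congrFun (congrFun h j) j
    simpa [hPdef] using h'
  have hPρP : P * ρ * P = ρ j j • P := single_mul_mul_single_same ρ j j
  -- Eigenvectors of `L`: a stationary part (0), the coherences with site `j` (-1), and the excess
  -- population of `j` (-2). They sum to `ρ`, which determines the semigroup.
  have h0 : L ((1 - P) * ρ * (1 - P) + ρ j j • E) =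
      (0 : ℂ) • ((1 - P) * ρ * (1 - P) + ρ j j • E) := by
    have h1 : P * ((1 - P) * ρ * (1 - P) + ρ j j • E) = 0 := by
      rw [mul_add, ← mul_assoc, ← mul_assoc, hPQ, Matrix.mul_smul, hPE]; simp
    have h2 : ((1 - P) * ρ * (1 - P) + ρ j j • E) * P = 0 := by
      rw [add_mul, mul_assoc, hQP, Matrix.smul_mul, hEP]; simp
    rw [hL, h1, h2, hleft _ h1]; simp
  have h1 : L (P * ρ * (1 - P) + (1 - P) * ρ * P) =
      (-1 : ℂ) • (P * ρ * (1 - P) + (1 - P) * ρ * P) := by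
    have h1 : P * (P * ρ * (1 - P) + (1 - P) * ρ * P) = P * ρ * (1 - P) := by
      rw [mul_add, ← mul_assoc, ← mul_assoc, ← mul_assoc, ← mul_assoc, hPQ, hPP]; simp
    have h2 : (P * ρ * (1 - P) + (1 - P) * ρ * P) * P = (1 - P) * ρ * P := by
      rw [add_mul, mul_assoc, hQP, mul_assoc _ P P, hPP]; simp
    have hj : (P * ρ * (1 - P) + (1 - P) * ρ * P) j j = 0 := by
      rw [Matrix.add_apply, hright (P * ρ * (1 - P)) (by rw [mul_assoc, hQP, mul_zero]),
        hleft ((1 - P) * ρ * P) (by rw [← mul_assoc, ← mul_assoc, hPQ, zero_mul, zero_mul]),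
        add_zero]
    rw [hL, h1, h2, hj]
    simp only [mul_zero, zero_smul, neg_smul, one_smul]
    abel
  have h2 : L (ρ j j • (P - E)) = (-2 : ℂ) • (ρ j j • (P - E)) := by
    rw [map_smul, hL, mul_sub, sub_mul, hPP, hPE, hEP, Matrix.sub_apply, hPj, hEj]
    module
  have hsplit : ρ = ((1 - P) * ρ * (1 - P) + ρ j j • E) + (P * ρ * (1 - P) + (1 - P) * ρ * P) +
      ρ j j • (P - E) := by
    rw [smul_sub, ← hPρP]
    noncomm_ring
  have hexp : Complex.exp (t * -2) = Complex.exp (-t) ^ 2 := by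
    rw [← Complex.exp_nat_mul]; congr 1; push_cast; ring
  conv_lhs => rw [hsplit, map_add, map_add, semigroup_apply_of_eigenvector h0,
    semigroup_apply_of_eigenvector h1, semigroup_apply_of_eigenvector h2, hexp, mul_zero,
    Complex.exp_zero, one_smul, mul_neg_one]
  generalize Complex.exp (-t) = s
  simp only [add_mul, mul_add, sub_mul, mul_sub, one_mul, mul_one, Matrix.smul_mul,
    Matrix.mul_smul, hPρP]
  module

/-- Both Kraus terms are positive, and the weight `K * K` removes from site `j` is what the jump
term restores at `i`. -/
theorem preservesDensity_semigroup_single {i j : Fin d} (hij : i ≠ j) {t : ℝ} (ht : 0 ≤ t) :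
    PreservesDensity (semigroup (lindbladian (Matrix.single i j (1 : ℂ))) t) := by
  intro ρ hρ
  rw [semigroup_single_apply hij]
  have hs : Complex.exp (-t) = (Real.exp (-t) : ℂ) := by push_cast; rfl
  have hs1 : Real.exp (-t) ^ 2 ≤ 1 :=
    pow_le_one₀ (Real.exp_pos _).le (Real.exp_le_one_iff.mpr (by linarith))
  rw [hs]
  set s := Real.exp (-t)
  set K : Op d := 1 + ((s : ℂ) - 1) • Matrix.single j j (1 : ℂ) with hK
  have hKH : Kᴴ = K := by simp [hK, Matrix.conjTranspose_single]
  have hPρ : (Matrix.single j j (1 : ℂ) * ρ).trace = ρ j j := by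
    simp [Matrix.trace_single_mul]
  refine ⟨?_, ?_⟩
  · have h1 := hρ.1.mul_mul_conjTranspose_same K
    rw [hKH] at h1
    have h2 := hρ.1.mul_mul_conjTranspose_same (Matrix.single i j (1 : ℂ))
    rw [Matrix.conjTranspose_single, star_one, single_mul_mul_single_same] at h2
    rw [mul_smul]
    refine h1.add (h2.smul ?_)
    rw [sub_nonneg]
    exact_mod_cast hs1
  · have hKK : K * K = 1 + ((s : ℂ) ^ 2 - 1) • Matrix.single j j (1 : ℂ) := by
      simp only [hK, add_mul, mul_add, one_mul, mul_one, Matrix.smul_mul, Matrix.mul_smul,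
        Matrix.single_mul_single_same]
      module
    rw [Matrix.trace_add, Matrix.trace_mul_comm, ← mul_assoc, hKK, add_mul, one_mul,
      Matrix.trace_add, hρ.2, Matrix.smul_mul, Matrix.trace_smul, Matrix.trace_smul, hPρ,
      Matrix.trace_single_eq_same, smul_eq_mul, smul_eq_mul]
    ring

theorem semigroup_single_realDiagonal {i j : Fin d} (hij : i ≠ j) (p : Fin d → ℝ) (t : ℝ) :
    semigroup (lindbladian (Matrix.single i j (1 : ℂ))) t (realDiagonal p) =
      realDiagonal (p + (p j * (1 - Real.exp (-t) ^ 2)) • (Pi.single i 1 - Pi.single j 1)) := by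
  rw [semigroup_single_apply hij]
  have hs : Complex.exp (-t) = (Real.exp (-t) : ℂ) := by push_cast; rfl
  have hone : (1 : Op d) = Matrix.diagonal fun _ => 1 := Matrix.diagonal_one.symm
  rw [hs, ← Matrix.diagonal_single, ← Matrix.diagonal_single, hone, realDiagonal, realDiagonal,
    ← Matrix.diagonal_smul, ← Matrix.diagonal_smul, Matrix.diagonal_add,
    Matrix.diagonal_mul_diagonal, Matrix.diagonal_mul_diagonal, Matrix.diagonal_add,
    Matrix.diagonal_apply_eq]
  congr 1
  ext k
  by_cases hki : k = i
  · subst hki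
    simp [hij]
    ring
  by_cases hkj : k = j
  · subst hkj
    simp [hki]
    ring
  simp [hki, hkj]

/-! ### Redistribution of diagonal weight -/

/-- Moving an amount `c` of weight from site `j` to site `i`. -/
theorem reach_transfer_of_jump {i j : Fin d} (hij : i ≠ j) (hS : Matrix.single i j (1 : ℂ) ∈ S)
    {p : Fin d → ℝ} {c : ℝ} (hc : 0 ≤ c) (hcp : c ≤ p j) :
    Reach S (realDiagonal p) (realDiagonal (p + c • (Pi.single i 1 - Pi.single j 1))) := by
  have hlt : ∀ c ∈ Set.Ico 0 (p j),
      Reach S (realDiagonal p) (realDiagonal (p + c • (Pi.single i 1 - Pi.single j 1))) := by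
    rintro c ⟨hc, hcp⟩
    have hp : 0 < p j := hc.trans_lt hcp
    have hpos : 0 < 1 - c / p j := by rw [sub_pos, div_lt_one hp]; exact hcp
    have hle : 1 - c / p j ≤ 1 := by rw [sub_le_self_iff]; positivity
    -- This time solves p_j (1 - e^{-2t}) = c; it is finite only for c < p_j.
    have ht : 0 ≤ -Real.log (1 - c / p j) / 2 := by
      have := Real.log_nonpos hpos.le hle
      linarith
    have h := Reach.of_chan (.jump (S := S) _ (-Real.log (1 - c / p j) / 2) hS
      ht)
      (preservesDensity_semigroup_single hij ht) (realDiagonal p)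
    rw [semigroup_single_realDiagonal hij] at h
    convert h using 4
    rw [← Real.exp_nat_mul, show ((2 : ℕ) : ℝ) * -(-Real.log (1 - c / p j) / 2) =
      Real.log (1 - c / p j) by push_cast; ring, Real.exp_log hpos]
    field_simp
    ring
  -- Complete transfer is a limit of partial ones. The case p_j = 0 is separate because the
  -- half-open interval is then empty.
  rcases (hc.trans hcp).eq_or_lt with h0 | h0
  · obtain rfl : c = 0 := le_antisymm (hcp.trans h0.symm.le) hc
    simpa using Reach.refl S _
  · have hmem : c ∈ closure (Set.Ico 0 (p j)) := by
      rw [closure_Ico h0.ne]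
      exact ⟨hc, hcp⟩
    have hcont : Continuous fun c : ℝ =>
        realDiagonal (p + c • (Pi.single i 1 - Pi.single j 1)) := by
      unfold realDiagonal
      refine Continuous.matrix_diagonal (continuous_pi fun k => ?_)
      simp only [Pi.add_apply, Pi.smul_apply]
      fun_prop
    have h := Set.MapsTo.closure (fun c hc => hlt c hc) hcont hmem
    rwa [closure_closure] at h

theorem exists_perm_apply_eq {α : Type*} [DecidableEq α] {a b i j : α} (hab : a ≠ b)
    (hij : i ≠ j) : ∃ e : Equiv.Perm α, e a = i ∧ e b = j := by
  refine ⟨(Equiv.swap a i).trans (Equiv.swap (Equiv.swap a i b) j), ?_, by simp⟩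
  rw [Equiv.trans_apply, Equiv.swap_apply_left]
  refine Equiv.swap_apply_of_ne_of_ne (fun h => hab ?_) hij
  apply (Equiv.swap a i).injective
  rw [Equiv.swap_apply_left, ← h]

/-- Permute the sites so that the pair `i`, `j` occupies the positions of the available jump,
transfer, and permute back. -/
theorem reach_transfer [NeZero d] (hS : IsHormanderSystem (antiHermitianSpan S)) {a b : Fin d}
    (hab : a ≠ b) (ha : Matrix.single a b (1 : ℂ) ∈ S) {i j : Fin d} (hij : i ≠ j)
    {p : Fin d → ℝ} {c : ℝ} (hc : 0 ≤ c) (hcp : c ≤ p j) :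
    Reach S (realDiagonal p) (realDiagonal (p + c • (Pi.single i 1 - Pi.single j 1))) := by
  obtain ⟨e, rfl, rfl⟩ := exists_perm_apply_eq hab hij
  have h₁ := reach_realDiagonal_perm hS p e
  have h₂ := reach_transfer_of_jump hab ha (p := p ∘ e) hc hcp
  have h₃ := reach_realDiagonal_perm hS (p ∘ e + c • (Pi.single a 1 - Pi.single b 1)) e⁻¹
  convert (h₁.trans h₂).trans h₃ using 2
  ext k
  simp [Pi.single_apply, Equiv.symm_apply_eq]

/-- Any weight vector on the diagonal can be steered to any other one of the same total weight. -/
theorem reach_realDiagonal [NeZero d] (hS : IsHormanderSystem (antiHermitianSpan S)) {a b : Fin d}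
    (hab : a ≠ b) (ha : Matrix.single a b (1 : ℂ) ∈ S) {p q : Fin d → ℝ}
    (hsum : ∑ i, p i = ∑ i, q i) (hp : ∀ i, 0 ≤ p i) (hq : ∀ i, 0 ≤ q i) :
    Reach S (realDiagonal p) (realDiagonal q) := by
  induction hn : (Finset.univ.filter fun i => p i ≠ q i).card using Nat.strong_induction_on
    generalizing p with
  | _ n ih =>
    by_cases hpq : p = q
    · exact hpq ▸ Reach.refl S _
    obtain ⟨k, hk⟩ := Function.ne_iff.mp hpq
    obtain ⟨i, -, hi⟩ : ∃ i ∈ Finset.univ, p i < q i := by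
      by_contra! h
      exact hk ((Finset.sum_eq_sum_iff_of_le h).mp hsum.symm k (Finset.mem_univ _)).symm
    obtain ⟨j, -, hj⟩ : ∃ j ∈ Finset.univ, q j < p j := by
      by_contra! h
      exact hk ((Finset.sum_eq_sum_iff_of_le h).mp hsum k (Finset.mem_univ _))
    have hij : i ≠ j := by
      rintro rfl
      exact lt_asymm hi hj
    -- One site with a deficit and one with a surplus are paired. The smaller discrepancy is moved,
    -- so at least one site becomes correct and none is spoiled; the number of wrong sites drops.
    set c := min (q i - p i) (p j - q j) with hc
    have hci : c ≤ q i - p i := min_le_left _ _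
    have hcj : c ≤ p j - q j := min_le_right _ _
    have hc0 : 0 ≤ c := le_min (by linarith) (by linarith)
    set p' : Fin d → ℝ := p + c • (Pi.single i 1 - Pi.single j 1) with hp'
    have hpi : p' i = p i + c := by simp [hp', hij]
    have hpj : p' j = p j - c := by simp [hp', hij.symm, sub_eq_add_neg]
    have hpk (k : Fin d) (h1 : k ≠ i) (h2 : k ≠ j) : p' k = p k := by simp [hp', h1, h2]
    refine (reach_transfer hS hab ha hij hc0 (by linarith [hq j])).trans (ih _ ?_ ?_ ?_ rfl)
    · rw [← hn]
      refine Finset.card_lt_card (Finset.ssubset_iff_of_subset ?_ |>.mpr ?_)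
      · intro k
        simp only [Finset.mem_filter, Finset.mem_univ, true_and]
        intro hk'
        by_cases h1 : k = i
        · exact h1 ▸ hi.ne
        by_cases h2 : k = j
        · exact h2 ▸ hj.ne'
        rwa [← hp', hpk k h1 h2] at hk'
      · rcases min_choice (q i - p i) (p j - q j) with h | h
        · refine ⟨i, by simpa using hi.ne, ?_⟩
          simp only [Finset.mem_filter, Finset.mem_univ, true_and, not_not]
          rw [← hp', hpi, hc, h, add_sub_cancel]
        · refine ⟨j, by simpa using hj.ne', ?_⟩
          simp only [Finset.mem_filter, Finset.mem_univ, true_and, not_not]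
          rw [← hp', hpj, hc, h, sub_sub_cancel]
    · rw [← hsum, ← hp']
      simp [hp', Finset.sum_add_distrib, ← Finset.mul_sum]
    · intro k
      rw [← hp']
      by_cases h1 : k = i
      · rw [h1, hpi]; linarith [hp i]
      by_cases h2 : k = j
      · rw [h2, hpj]; linarith [hq j]
      rw [hpk k h1 h2]; exact hp k

/-! ### Arbitrary densities and the limiting evolution -/

theorem IsDensity.exists_unitary_diagonal {ρ : Op d} (hρ : IsDensity ρ) :
    ∃ U ∈ unitary (Op d), ∃ p : Fin d → ℝ, (∀ i, 0 ≤ p i) ∧ ∑ i, p i = 1 ∧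
      ρ = U * realDiagonal p * Uᴴ ∧ Uᴴ * ρ * U = realDiagonal p := by
  have hH := hρ.1.isHermitian
  have h := hH.spectral_theorem
  have h' := hH.conjStarAlgAut_star_eigenvectorUnitary
  rw [Unitary.conjStarAlgAut_apply] at h
  rw [Unitary.conjStarAlgAut_star_apply] at h'
  refine ⟨hH.eigenvectorUnitary, hH.eigenvectorUnitary.2, hH.eigenvalues,
    hρ.1.eigenvalues_nonneg, ?_, h, h'⟩
  have ht := hρ.2
  rw [hH.trace_eq_sum_eigenvalues] at ht
  have := congrArg Complex.re ht
  simpa using this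

theorem reach_of_isDensity [NeZero d] (hS : IsHormanderSystem (antiHermitianSpan S)) {a b : Fin d}
    (hab : a ≠ b) (ha : Matrix.single a b (1 : ℂ) ∈ S) {ρ σ : Op d} (hρ : IsDensity ρ)
    (hσ : IsDensity σ) : Reach S ρ σ := by
  obtain ⟨U, hU, p, hp, hp1, -, hρp⟩ := hρ.exists_unitary_diagonal
  obtain ⟨V, hV, q, hq, hq1, hσq, -⟩ := hσ.exists_unitary_diagonal
  have h₁ := Reach.unitary_conj hS (Unitary.star_mem hU) ρ
  rw [Matrix.star_eq_conjTranspose, Matrix.conjTranspose_conjTranspose, hρp] at h₁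
  have h₂ := reach_realDiagonal hS hab ha (hp1.trans hq1.symm) hp hq
  have h₃ := Reach.unitary_conj hS hV (realDiagonal q)
  rw [← hσq] at h₃
  exact (h₁.trans h₂).trans h₃

/-- If every density can be steered approximately to every other one, then suitable corrections,
applied at integer times, steer it to that density in the limit. -/
theorem isTransitive_of_reach {d : ℕ} {S : Set (Op d)}
    (h : ∀ ρ σ : Op d, IsDensity ρ → IsDensity σ → Reach S ρ σ) : IsTransitive (chan S) := by
  intro ρ σ hρ hσ
  have : FirstCountableTopology (Op d) :=
    inferInstanceAs (FirstCountableTopology (Fin d → Fin d → ℂ))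
  obtain ⟨V, hV⟩ := (𝓝 σ).exists_antitone_basis
  have hstep (n : ℕ) (τ : {τ : Op d // IsDensity τ}) :
      ∃ Φ : SuperOp d, Chan S Φ ∧ PreservesDensity Φ ∧ Φ τ ∈ V n := by
    obtain ⟨_, hmem, Φ, hΦ, hd, rfl⟩ := mem_closure_iff_nhds.mp (h τ σ τ.2 hσ) (V n) (hV.mem n)
    exact ⟨Φ, hΦ, hd, hmem⟩
  choose Φ hΦ hd hmem using hstep
  -- Each correction depends on the state reached so far; carrying density preservation along keeps
  -- that state a density, so the next correction exists.
  let Ψ : ℕ → {Ψ : SuperOp d // PreservesDensity Ψ} := fun n =>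
    Nat.rec ⟨LinearMap.id, fun _ h => h⟩ (fun n Ψ =>
      ⟨Φ n ⟨Ψ.1 ρ, Ψ.2 ρ hρ⟩ ∘ₗ Ψ.1, fun τ hτ => hd _ _ _ (Ψ.2 τ hτ)⟩) n
  have hsucc (n : ℕ) : (Ψ (n + 1)).1 = Φ n ⟨(Ψ n).1 ρ, (Ψ n).2 ρ hρ⟩ ∘ₗ (Ψ n).1 := rfl
  have hle : ∀ m n, m ≤ n → ∃ Θ ∈ chan S, (Ψ n).1 = Θ ∘ₗ (Ψ m).1 := by
    intro m n hmn
    induction n, hmn using Nat.le_induction with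
    | base => exact ⟨LinearMap.id, chan_id S, rfl⟩
    | succ n _ ih =>
      obtain ⟨Θ, hΘ, hΨ⟩ := ih
      exact ⟨_, .comp _ _ (hΦ n ⟨(Ψ n).1 ρ, (Ψ n).2 ρ hρ⟩) hΘ, by
        rw [hsucc, LinearMap.comp_assoc, ← hΨ]⟩
  -- The evolution is constant between integer times; no continuity in `t` is required.
  refine ⟨fun t => (Ψ ⌊t⌋₊).1, ⟨?_, fun s t hst => hle _ _ (Nat.floor_mono hst)⟩, Or.inr ?_⟩
  · simp only [Nat.floor_zero]
    rfl
  · have hlim : Tendsto (fun n => (Ψ n).1 ρ) atTop (𝓝 σ) :=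
      (tendsto_add_atTop_iff_nat 1).mp
        (hV.tendsto fun n => hmem n ⟨(Ψ n).1 ρ, (Ψ n).2 ρ hρ⟩)
    exact hlim.comp tendsto_nat_floor_atTop

end QControl

theorem theorem2p6 (d : ℕ) (hd : 2 ≤ d) (S : Set (QControl.Op d))
    (hstar : ∀ a ∈ S, aᴴ ∈ S)
    (hS : QControl.IsHormanderSystem (QControl.antiHermitianSpan S))
    (ha : Matrix.single (⟨0, by omega⟩ : Fin d) (⟨1, by omega⟩ : Fin d) (1 : ℂ) ∈ S) :
    QControl.IsTransitive (QControl.chan S) := by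
  have : NeZero d := ⟨by omega⟩
  exact QControl.isTransitive_of_reach fun ρ σ hρ hσ =>
    QControl.reach_of_isDensity hS (by simp) ha hρ hσ
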